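/- Let $\mathbb{H}$ be the Heisenberg group, that is, $\mathbb{R}^3$ with the group law $$p\cdot q=\bigl(x_p+x_q,\;y_p+y_q,\;z_p+z_q+\tfrac12(x_py_q-y_px_q)\bigr),$$ with the dilations $\delta_\lambda(x,y,z)=(\lambda x,\lambda y,\lambda^2z)$ for $\lambda>0$. Let $d_{cc}$ be the Carnot–Carathéodory distance on $\mathbb{H}$: $d_{cc}(p,q)$ is the infimum of the lengths $\int\sqrt{\dot x^2+\dot y^2}\,dt$ of the absolutely continuous curves from $p$ to $q$ that satisfy $\dot z=\tfrac12(x\dot y-y\dot x)$ almost everywhere. A function $d:\mathbb{H}\times\mathbb{H}\to\mathbb{R}$ is *left-invariant* if $d(gp,gq)=d(p,q)$ for all $g,p,q\in\mathbb{H}$, and *self-similar* if there is some $\lambda>1$ such that $d(\delta_\lambda(p),\delta_\lambda(q))=\lambda\,d(p,q)$ for all $p,q\in\mathbb{H}$. A *blow-up* of a distance $d$ is any pointwise limit of the functions $$(p_1,p_2)\mapsto\frac1{\lambda_j}\,d\bigl(q_j\delta_{\lambda_j}(p_1),q_j\delta_{\lambda_j}(p_2)\bigr),$$ where $\lambda_j>0$,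 $\lambda_j\to0$ and $q_j\in\mathbb{H}$. Two distances $d,d'$ on $\mathbb{H}$ are *biLipschitz equivalent* if there is $C\ge1$ such that $C^{-1}d'(p,q)\le d(p,q)\le C\,d'(p,q)$ for all $p,q\in\mathbb{H}$. **Theorem.** There exist two distances $d_1,d_2$ on $\mathbb{H}$, both biLipschitz equivalent to $d_{cc}$, such that 1. $d_1$ is left-invariant, but no blow-up of $d_1$ is self-similar; 2. no blow-up of $d_2$ is left-invariant, and no blow-up of $d_2$ is self-similar. -/

import Mathlib

open MeasureTheory Filter Topology

/-- The Heisenberg group in exponential coordinates: the manifold `ℝ³`, with the group law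
`p * q = (x_p + x_q, y_p + y_q, z_p + z_q + (x_p y_q - y_p x_q) / 2)` given below. -/
@[ext]
structure Heis where
  x : ℝ
  y : ℝ
  z : ℝ

namespace Heis

noncomputable instance : Mul Heis :=
  ⟨fun p q => ⟨p.x + q.x, p.y + q.y, p.z + q.z + (1 / 2) * (p.x * q.y - p.y * q.x)⟩⟩

instance : One Heis := ⟨⟨0, 0, 0⟩⟩

instance : Inv Heis := ⟨fun p => ⟨-p.x, -p.y, -p.z⟩⟩

@[simp] theorem mul_x (p q : Heis) : (p * q).x = p.x + q.x := rfl

@[simp] theorem mul_y (p q : Heis) : (p * q).y = p.y + q.y := rfl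

@[simp] theorem mul_z (p q : Heis) :
    (p * q).z = p.z + q.z + (1 / 2) * (p.x * q.y - p.y * q.x) := rfl

@[simp] theorem one_x : (1 : Heis).x = 0 := rfl

@[simp] theorem one_y : (1 : Heis).y = 0 := rfl

@[simp] theorem one_z : (1 : Heis).z = 0 := rfl

@[simp] theorem inv_x (p : Heis) : (p⁻¹).x = -p.x := rfl

@[simp] theorem inv_y (p : Heis) : (p⁻¹).y = -p.y := rfl

@[simp] theorem inv_z (p : Heis) : (p⁻¹).z = -p.z := rfl

noncomputable instance : Group Heis :=
  Group.ofLeftAxioms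
    (fun p q r => by ext <;> simp <;> ring)
    (fun p => by ext <;> simp)
    (fun p => by ext <;> simp; ring)

/-- The standard dilation `δ_l (x, y, z) = (l x, l y, l² z)`. -/
def dil (l : ℝ) (p : Heis) : Heis := ⟨l * p.x, l * p.y, l ^ 2 * p.z⟩

/-- `γ` restricted to `[a, b]` is a horizontal curve: it is absolutely continuous, and at almost
every time its velocity `(x', y', z')` lies in the horizontal plane spanned by the left-invariant
vector fields `X = ∂_x - (y/2) ∂_z` and `Y = ∂_y + (x/2) ∂_z`; that is, the velocity equals
`x' X + y' Y`, which says `z' = (x y' - y x') / 2`. -/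
structure IsHorizontal (γ : ℝ → Heis) (a b : ℝ) : Prop where
  ac_x : AbsolutelyContinuousOnInterval (fun t => (γ t).x) a b
  ac_y : AbsolutelyContinuousOnInterval (fun t => (γ t).y) a b
  ac_z : AbsolutelyContinuousOnInterval (fun t => (γ t).z) a b
  velocity : ∀ᵐ t ∂(volume.restrict (Set.Icc a b)),
    deriv (fun s => (γ s).z) t =
      (1 / 2) * ((γ t).x * deriv (fun s => (γ s).y) t - (γ t).y * deriv (fun s => (γ s).x) t)

/-- The sub-Riemannian length of a horizontal curve on `[a, b]`, for the metric on the horizontal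
bundle that makes `X, Y` orthonormal: the integral of `|x' X + y' Y| = √(x'² + y'²)`.
The integrand is integrable for every horizontal curve, by absolute continuity. -/
noncomputable def hlength (γ : ℝ → Heis) (a b : ℝ) : ℝ :=
  ∫ t in a..b, Real.sqrt (deriv (fun s => (γ s).x) t ^ 2 + deriv (fun s => (γ s).y) t ^ 2)

/-- The Carnot-Carathéodory distance: the infimum of the lengths of the horizontal curves from
`p` to `q`. (Any two points of the Heisenberg group are joined by a horizontal curve, so the
infimum is over a nonempty set of nonnegative numbers.) -/
noncomputable def dcc (p q : Heis) : ℝ :=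
  sInf {L : ℝ | ∃ (γ : ℝ → Heis) (a b : ℝ), a ≤ b ∧ IsHorizontal γ a b ∧
    γ a = p ∧ γ b = q ∧ L = hlength γ a b}

/-- `d` is a distance (a metric) on the Heisenberg group. -/
structure IsDistance (d : Heis → Heis → ℝ) : Prop where
  nonneg : ∀ p q, 0 ≤ d p q
  eq_zero_iff : ∀ p q, d p q = 0 ↔ p = q
  symm : ∀ p q, d p q = d q p
  triangle : ∀ p q r, d p r ≤ d p q + d q r

/-- The functions `d` and `d'` are biLipschitz equivalent (through the identity map). -/
def BiLipschitzEquivalent (d d' : Heis → Heis → ℝ) : Prop :=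
  ∃ C : ℝ, 1 ≤ C ∧ ∀ p q, C⁻¹ * d' p q ≤ d p q ∧ d p q ≤ C * d' p q

def LeftInvariant (d : Heis → Heis → ℝ) : Prop :=
  ∀ g p q, d (g * p) (g * q) = d p q

/-- `d` is self-similar: some dilation with factor `l > 1` multiplies `d` by `l`. -/
def SelfSimilar (d : Heis → Heis → ℝ) : Prop :=
  ∃ l : ℝ, 1 < l ∧ ∀ p q, d (dil l p) (dil l q) = l * d p q

/-- `ρ` is a blow-up of `d`: a pointwise limit of the functions
`(p₁, p₂) ↦ (1 / l_j) d (q_j δ_{l_j} p₁, q_j δ_{l_j} p₂)` for some scales `l_j > 0` tending to `0`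
and some points `q_j`. -/
def IsBlowUp (d ρ : Heis → Heis → ℝ) : Prop :=
  ∃ (l : ℕ → ℝ) (q : ℕ → Heis), (∀ j, 0 < l j) ∧ Tendsto l atTop (𝓝 0) ∧
    ∀ p₁ p₂, Tendsto (fun j => (1 / l j) * d (q j * dil (l j) p₁) (q j * dil (l j) p₂))
      atTop (𝓝 (ρ p₁ p₂))

end Heis

/-!
The first distance is `leftDist p q = oscNorm (p⁻¹ * q)`. On the vertical axis `oscNorm` is
`profile s = √s (10 + cos t + cos (√2 t))`, where `t = (log s) / 2` is the logarithmic scale. A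
blow-up of `leftDist` sees limits of translates in `t` of this coefficient, and a self-similar
blow-up would make such a limit periodic. No limit of translates is periodic, because the
frequencies `1` and `√2` are incommensurable (`eq_zero_of_osc_translate`). The triangle inequality
is proved in `profile_add_le`. It rests on the monotonicity of `s / g - g / 1000` for
`g = profile s`, which holds because the oscillation is slow and small compared with `10`.

The second distance is `leftDist + waveDist / 10`. The pseudodistance `waveDist` is the supremum of
`|f p - f q|` over a family of Lipschitz functions `f`: rescaled and translated copies, at every
scale `16 ^ (-k)`, of a wave `tent x * exp (i (z + x y / 2))`. These functions are smooth in the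
vertical direction, so a vertical pair essentially sees only the waves of its own scale
(`waveDist_vertical_le`), whose amplitude depends on `x`. This dependence is present at all scales
and all places, so it survives in every blow-up, and no blow-up is left-invariant
(`not_leftInvariant_of_isBlowUp`). The factor `1 / 10` keeps the perturbation too small to
compensate for the aperiodicity of the profile, which is stable: if no multiple of a rotation is
far from the identity, then the rotation is trivial (`not_selfSimilar_of_isBlowUp`).

Both distances are compared with the Carnot-Carathéodory distance through the gauge
`|x| + |y| + √|z|`: `gauge_le_hlength` bounds the gauge by the length of any horizontal curve, and
`exists_isHorizontal` joins two points by an explicit polynomial curve.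
-/

namespace Heis

/-! ### The homogeneous gauge and the Carnot-Carathéodory distance -/

/-- The homogeneous gauge `|x| + |y| + √|z|`. It is not subadditive, but `gauge (p⁻¹ * q)` is
comparable with the Carnot-Carathéodory distance, see `dcc_le_gauge` and `gauge_le_dcc`. -/
noncomputable def gauge (h : Heis) : ℝ := |h.x| + |h.y| + √|h.z|

theorem gauge_nonneg (h : Heis) : 0 ≤ gauge h := by unfold gauge; positivity

theorem gauge_dil {l : ℝ} (hl : 0 < l) (h : Heis) : gauge (dil l h) = l * gauge h := by
  simp only [gauge, dil, abs_mul, abs_pow, abs_of_pos hl]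
  rw [Real.sqrt_mul (by positivity), Real.sqrt_sq hl.le]
  ring

theorem dil_mul (l : ℝ) (p q : Heis) : dil l (p * q) = dil l p * dil l q := by
  ext <;> simp [dil] <;> ring

theorem dil_inv (l : ℝ) (p : Heis) : dil l p⁻¹ = (dil l p)⁻¹ := by
  ext <;> simp [dil]

/-- The gauge distance bounds the length of a horizontal curve from below: the increments of `x`
and `y` are bounded by the length `L`, and the vertical coordinate of `p⁻¹ * γ` grows at a rate
at most `L` times the speed. -/
theorem gauge_le_hlength {γ : ℝ → Heis} {a b : ℝ} (hab : a ≤ b) (hγ : IsHorizontal γ a b) :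
    gauge ((γ a)⁻¹ * γ b) ≤ 3 * hlength γ a b := by
  set u : ℝ → ℝ := fun t => deriv (fun s => (γ s).x) t with hu
  set v : ℝ → ℝ := fun t => deriv (fun s => (γ s).y) t with hv
  have iu : IntervalIntegrable u volume a b := hγ.ac_x.intervalIntegrable_deriv
  have iv : IntervalIntegrable v volume a b := hγ.ac_y.intervalIntegrable_deriv
  have isp : IntervalIntegrable (fun t => √(u t ^ 2 + v t ^ 2)) volume a b := by
    refine (iu.abs.add iv.abs).mono_fun ?_ (Eventually.of_forall fun t => ?_)
    · exact (((measurable_deriv _).pow_const 2).add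
        ((measurable_deriv _).pow_const 2)).sqrt.aestronglyMeasurable
    · dsimp only
      rw [Real.norm_of_nonneg (Real.sqrt_nonneg _), Real.norm_of_nonneg (by positivity)]
      refine Real.sqrt_le_iff.2 ⟨by positivity, ?_⟩
      nlinarith [sq_abs (u t), sq_abs (v t), mul_nonneg (abs_nonneg (u t)) (abs_nonneg (v t))]
  set L := hlength γ a b with hL
  have hLdef : L = ∫ t in a..b, √(u t ^ 2 + v t ^ 2) := rfl
  have ule : ∀ t, |u t| ≤ √(u t ^ 2 + v t ^ 2) := fun t =>
    Real.abs_le_sqrt (by nlinarith [sq_nonneg (v t)])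
  have vle : ∀ t, |v t| ≤ √(u t ^ 2 + v t ^ 2) := fun t =>
    Real.abs_le_sqrt (by nlinarith [sq_nonneg (u t)])
  -- A primitive on an initial piece of `[a, b]` is bounded by the whole length.
  have key : ∀ f : ℝ → ℝ, AbsolutelyContinuousOnInterval f a b →
      (∀ t, |deriv f t| ≤ √(u t ^ 2 + v t ^ 2)) → ∀ t ∈ Set.Icc a b, |f t - f a| ≤ L := by
    intro f hf hle t ht
    have hsub : Set.uIcc a t ⊆ Set.uIcc a b := by
      rw [Set.uIcc_of_le ht.1, Set.uIcc_of_le hab]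
      exact Set.Icc_subset_Icc_right ht.2
    have hf' := hf.mono hsub
    rw [← hf'.integral_deriv_eq_sub]
    calc |∫ s in a..t, deriv f s| ≤ ∫ s in a..t, |deriv f s| :=
          intervalIntegral.abs_integral_le_integral_abs ht.1
      _ ≤ ∫ s in a..t, √(u s ^ 2 + v s ^ 2) :=
          intervalIntegral.integral_mono_on ht.1 hf'.intervalIntegrable_deriv.abs
            (isp.mono_set hsub) fun s _ => hle s
      _ ≤ L := by
          rw [hLdef]
          exact intervalIntegral.integral_mono_interval le_rfl ht.1 ht.2
            (Eventually.of_forall fun s => Real.sqrt_nonneg _) isp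
  have hx := key _ hγ.ac_x ule
  have hy := key _ hγ.ac_y vle
  have hL0 : 0 ≤ L := (abs_nonneg _).trans (hx a ⟨le_rfl, hab⟩)
  have hz : |((γ a)⁻¹ * γ b).z| ≤ L ^ 2 := by
    have e1 : ((γ a)⁻¹ * γ b).z = (∫ t in a..b, deriv (fun s => (γ s).z) t)
        - ((1 / 2) * (γ a).x * (∫ t in a..b, v t) - (1 / 2) * (γ a).y * ∫ t in a..b, u t) := by
      rw [hγ.ac_z.integral_deriv_eq_sub, hγ.ac_x.integral_deriv_eq_sub,
        hγ.ac_y.integral_deriv_eq_sub]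
      simp; ring
    have e2 : ((γ a)⁻¹ * γ b).z = ∫ t in a..b, (deriv (fun s => (γ s).z) t
        - ((1 / 2) * (γ a).x * v t - (1 / 2) * (γ a).y * u t)) := by
      rw [e1, intervalIntegral.integral_sub hγ.ac_z.intervalIntegrable_deriv
        ((iv.const_mul _).sub (iu.const_mul _)),
        intervalIntegral.integral_sub (iv.const_mul _) (iu.const_mul _),
        intervalIntegral.integral_const_mul, intervalIntegral.integral_const_mul]
    have e3 : L ^ 2 = ∫ t in a..b, L * √(u t ^ 2 + v t ^ 2) := by
      rw [intervalIntegral.integral_const_mul, ← hLdef, sq]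
    rw [e2, e3, ← Real.norm_eq_abs]
    refine intervalIntegral.norm_integral_le_of_norm_le hab ?_ (isp.const_mul L)
    have hvel := (ae_restrict_iff' measurableSet_Icc).1 hγ.velocity
    filter_upwards [hvel] with t ht htm
    have htm' : t ∈ Set.Icc a b := Set.Ioc_subset_Icc_self htm
    have e4 : deriv (fun s => (γ s).z) t
        - ((1 / 2) * (γ a).x * v t - (1 / 2) * (γ a).y * u t)
        = (1 / 2) * (((γ t).x - (γ a).x) * v t - ((γ t).y - (γ a).y) * u t) := by
      rw [ht htm']; ring
    rw [e4, Real.norm_eq_abs, abs_mul, abs_of_pos (by norm_num : (0 : ℝ) < 1 / 2)]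
    have h1 : |((γ t).x - (γ a).x) * v t| ≤ L * √(u t ^ 2 + v t ^ 2) := by
      rw [abs_mul]; exact mul_le_mul (hx t htm') (vle t) (abs_nonneg _) hL0
    have h2 : |((γ t).y - (γ a).y) * u t| ≤ L * √(u t ^ 2 + v t ^ 2) := by
      rw [abs_mul]; exact mul_le_mul (hy t htm') (ule t) (abs_nonneg _) hL0
    have h3 := abs_sub (((γ t).x - (γ a).x) * v t) (((γ t).y - (γ a).y) * u t)
    linarith
  have hx1 : |((γ a)⁻¹ * γ b).x| ≤ L := by
    have := hx b ⟨hab, le_rfl⟩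
    simpa [neg_add_eq_sub] using this
  have hy1 : |((γ a)⁻¹ * γ b).y| ≤ L := by
    have := hy b ⟨hab, le_rfl⟩
    simpa [neg_add_eq_sub] using this
  have hz1 : √|((γ a)⁻¹ * γ b).z| ≤ L := Real.sqrt_le_iff.2 ⟨hL0, hz⟩
  unfold gauge
  linarith

/-- Any two points are joined by a polynomial horizontal curve of length comparable with the gauge
distance. The horizontal projection is a segment plus multiples of the loops
`α = t - 3 t² + 2 t³` and `β = t - 6 t² + 10 t³ - 5 t⁴`. These vanish at `0` and `1` and have mean
zero, so the enclosed area has no term mixing loop and segment; the area form of `(α, β)` is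
`∫ (α β' - β α') = - 1 / 35`. -/
theorem exists_isHorizontal (p q : Heis) :
    ∃ γ : ℝ → Heis, IsHorizontal γ 0 1 ∧ γ 0 = p ∧ γ 1 = q ∧
      hlength γ 0 1 ≤ 23 * gauge (p⁻¹ * q) := by
  obtain ⟨a, b, c, rfl⟩ : ∃ a b c, q = p * ⟨a, b, c⟩ :=
    ⟨(p⁻¹ * q).x, (p⁻¹ * q).y, (p⁻¹ * q).z, by
      rw [show (⟨(p⁻¹ * q).x, (p⁻¹ * q).y, (p⁻¹ * q).z⟩ : Heis) = p⁻¹ * q from rfl,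
        mul_inv_cancel_left]⟩
  rw [inv_mul_cancel_left]
  -- The loop `(α, β)` is scaled by `(r, r')`, where `r * r' = - 70 c` produces the height `c`.
  obtain ⟨r, r', hrr, hr, hr'⟩ : ∃ r r' : ℝ, r * r' = -70 * c ∧ |r| ≤ 9 * √|c| ∧
      |r'| ≤ 9 * √|c| := by
    have h9 : √(70 * |c|) ≤ 9 * √|c| := by
      rw [Real.sqrt_le_left (by positivity), mul_pow, Real.sq_sqrt (abs_nonneg c)]
      linarith [abs_nonneg c]
    have hs : √(70 * |c|) * √(70 * |c|) = 70 * |c| := Real.mul_self_sqrt (by positivity)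
    have ha : |√(70 * |c|)| ≤ 9 * √|c| := by rwa [abs_of_nonneg (Real.sqrt_nonneg _)]
    rcases le_total 0 c with hc | hc
    · refine ⟨√(70 * |c|), -√(70 * |c|), ?_, ha, by rwa [abs_neg]⟩
      rw [mul_neg, hs, abs_of_nonneg hc]; ring
    · refine ⟨√(70 * |c|), √(70 * |c|), ?_, ha, ha⟩
      rw [hs, abs_of_nonpos hc]; ring
  let X : ℝ → ℝ := fun t => a * t + r * (t - 3 * t ^ 2 + 2 * t ^ 3)
  let Y : ℝ → ℝ := fun t => b * t + r' * (t - 6 * t ^ 2 + 10 * t ^ 3 - 5 * t ^ 4)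
  let Z : ℝ → ℝ := fun t =>
    (1 / 2) * (a * r' * (-2 * t ^ 3 + 5 * t ^ 4 - 3 * t ^ 5)
      + r * b * (t ^ 3 - t ^ 4)
      + r * r' * (-t ^ 3 + 4 * t ^ 4 - 33 / 5 * t ^ 5 + 5 * t ^ 6 - 10 / 7 * t ^ 7))
  let X' : ℝ → ℝ := fun t => a + r * (1 - 6 * t + 6 * t ^ 2)
  let Y' : ℝ → ℝ := fun t => b + r' * (1 - 12 * t + 30 * t ^ 2 - 20 * t ^ 3)
  have m : ∀ (k : ℝ) (n : ℕ) (t : ℝ), HasDerivAt (fun t : ℝ => k * t ^ n)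
      (k * (n * t ^ (n - 1))) t := fun k n t => (hasDerivAt_pow n t).const_mul k
  have conv : ∀ {f g : ℝ → ℝ} {f' g' t : ℝ}, HasDerivAt g g' t → f = g → f' = g' →
      HasDerivAt f f' t := by
    rintro _ _ _ _ _ h rfl rfl; exact h
  have hX : ∀ t, HasDerivAt X (X' t) t := by
    intro t
    refine conv (((m (a + r) 1 t).add (m (-3 * r) 2 t)).add (m (2 * r) 3 t)) ?_ ?_
    · funext t; simp [X]; ring
    · simp [X']; ring
  have hY : ∀ t, HasDerivAt Y (Y' t) t := by
    intro t
    refine conv ((((m (b + r') 1 t).add (m (-6 * r') 2 t)).add (m (10 * r') 3 t)).add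
      (m (-5 * r') 4 t)) ?_ ?_
    · funext t; simp [Y]; ring
    · simp [Y']; ring
  have hZ : ∀ t, HasDerivAt Z ((1 / 2) * (X t * Y' t - Y t * X' t)) t := by
    intro t
    refine conv (((((m (-a * r' + r * b / 2 - r * r' / 2) 3 t).add
      (m (5 / 2 * a * r' - r * b / 2 + 2 * r * r') 4 t)).add
      (m (-3 / 2 * a * r' - 33 / 10 * r * r') 5 t)).add (m (5 / 2 * r * r') 6 t)).add
      (m (-5 / 7 * r * r') 7 t)) ?_ ?_
    · funext t; simp [Z]; ring
    · simp [X, Y, X', Y']; ring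
  let γ : ℝ → Heis := fun t => p * ⟨X t, Y t, Z t⟩
  have hγx : ∀ t, HasDerivAt (fun s => (γ s).x) (X' t) t := fun t => (hX t).const_add p.x
  have hγy : ∀ t, HasDerivAt (fun s => (γ s).y) (Y' t) t := fun t => (hY t).const_add p.y
  have hγz : ∀ t, HasDerivAt (fun s => (γ s).z)
      ((1 / 2) * ((γ t).x * Y' t - (γ t).y * X' t)) t := by
    intro t
    refine conv (((hZ t).const_add p.z).add
      ((((hY t).const_mul p.x).sub ((hX t).const_mul p.y)).const_mul (1 / 2))) rfl ?_
    simp only [γ, mul_x, mul_y]; ring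
  have ac : ∀ {f f' : ℝ → ℝ}, (∀ t, HasDerivAt f (f' t) t) → Continuous f' →
      AbsolutelyContinuousOnInterval f 0 1 := by
    intro f f' hf hf'
    refine ContDiffOn.absolutelyContinuousOnInterval ?_
    refine ContDiff.contDiffOn (contDiff_one_iff_deriv.2 ⟨fun t => (hf t).differentiableAt, ?_⟩)
    rwa [show deriv f = f' from funext fun t => (hf t).deriv]
  have cX' : Continuous X' := by simp only [X']; fun_prop
  have cY' : Continuous Y' := by simp only [Y']; fun_prop
  have cX : Continuous X := by simp only [X]; fun_prop
  have cY : Continuous Y := by simp only [Y]; fun_prop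
  have hX1 : X 1 = a := by simp only [X]; ring
  have hY1 : Y 1 = b := by simp only [Y]; ring
  have hZ1 : Z 1 = c := by simp only [Z]; linear_combination (-1 / 70) * hrr
  refine ⟨γ, ⟨ac hγx cX', ac hγy cY', ac hγz ?_, ?_⟩, ?_, ?_, ?_⟩
  · simp only [γ, mul_x, mul_y]; fun_prop
  · refine Eventually.of_forall fun t => ?_
    rw [(hγx t).deriv, (hγy t).deriv, (hγz t).deriv]
  · ext <;> simp [γ, X, Y, Z]
  · ext
    · simp [γ, hX1]
    · simp [γ, hY1]
    · simp [γ, hX1, hY1, hZ1]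
  · have hb : ∀ t ∈ Set.uIoc (0 : ℝ) 1,
        ‖√(deriv (fun s => (γ s).x) t ^ 2 + deriv (fun s => (γ s).y) t ^ 2)‖
          ≤ 23 * gauge ⟨a, b, c⟩ := by
      intro t ht
      rw [Set.uIoc_of_le zero_le_one] at ht
      obtain ⟨h0, h1⟩ := ht
      rw [(hγx t).deriv, (hγy t).deriv, Real.norm_of_nonneg (Real.sqrt_nonneg _)]
      have hs0 : 0 ≤ t * (1 - t) := mul_nonneg h0.le (by linarith)
      have hs1 : t * (1 - t) ≤ 1 / 4 := by nlinarith [sq_nonneg (t - 1 / 2)]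
      have hα : |1 - 6 * t + 6 * t ^ 2| ≤ 1 := by
        rw [abs_le]; constructor <;> nlinarith
      have hβ : |1 - 12 * t + 30 * t ^ 2 - 20 * t ^ 3| ≤ 3 / 2 := by
        rw [show 1 - 12 * t + 30 * t ^ 2 - 20 * t ^ 3
          = (1 - 2 * t) * (1 - 10 * (t * (1 - t))) by ring, abs_mul]
        have e1 : |1 - 2 * t| ≤ 1 := by rw [abs_le]; constructor <;> linarith
        have e2 : |1 - 10 * (t * (1 - t))| ≤ 3 / 2 := by
          rw [abs_le]; constructor <;> linarith
        calc _ ≤ 1 * (3 / 2 : ℝ) := mul_le_mul e1 e2 (abs_nonneg _) zero_le_one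
          _ = _ := one_mul _
      have bX : |X' t| ≤ |a| + 9 * √|c| := by
        refine (abs_add_le _ _).trans (add_le_add le_rfl ?_)
        rw [abs_mul]
        nlinarith [abs_nonneg r, abs_nonneg (1 - 6 * t + 6 * t ^ 2)]
      have bY : |Y' t| ≤ |b| + 27 / 2 * √|c| := by
        refine (abs_add_le _ _).trans (add_le_add le_rfl ?_)
        rw [abs_mul]
        nlinarith [abs_nonneg r', abs_nonneg (1 - 12 * t + 30 * t ^ 2 - 20 * t ^ 3)]
      have hsq : √(X' t ^ 2 + Y' t ^ 2) ≤ |X' t| + |Y' t| := by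
        refine Real.sqrt_le_iff.2 ⟨by positivity, ?_⟩
        nlinarith [sq_abs (X' t), sq_abs (Y' t),
          mul_nonneg (abs_nonneg (X' t)) (abs_nonneg (Y' t))]
      simp only [gauge]
      linarith [abs_nonneg a, abs_nonneg b, Real.sqrt_nonneg |c|]
    have := intervalIntegral.norm_integral_le_of_norm_le_const hb
    rw [sub_zero, abs_one, mul_one] at this
    exact (le_abs_self _).trans this

theorem dcc_le_gauge (p q : Heis) : dcc p q ≤ 23 * gauge (p⁻¹ * q) := by
  obtain ⟨γ, hγ, h0, h1, hL⟩ := exists_isHorizontal p q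
  refine le_trans (csInf_le ⟨0, ?_⟩ ⟨γ, 0, 1, zero_le_one, hγ, h0, h1, rfl⟩) hL
  rintro L ⟨γ, a, b, hab, -, -, -, rfl⟩
  exact intervalIntegral.integral_nonneg hab fun t _ => Real.sqrt_nonneg _

theorem gauge_le_dcc (p q : Heis) : gauge (p⁻¹ * q) ≤ 3 * dcc p q := by
  suffices h : gauge (p⁻¹ * q) / 3 ≤ dcc p q by linarith
  obtain ⟨γ, hγ, h0, h1, -⟩ := exists_isHorizontal p q
  refine le_csInf ⟨_, γ, 0, 1, zero_le_one, hγ, h0, h1, rfl⟩ ?_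
  rintro L ⟨γ, a, b, hab, hγ, rfl, rfl, rfl⟩
  linarith [gauge_le_hlength hab hγ]

/-- A function that is comparable with the gauge distance is biLipschitz equivalent to the
Carnot-Carathéodory distance. -/
theorem biLipschitzEquivalent_dcc {d : Heis → Heis → ℝ} {A : ℝ}
    (hlow : ∀ p q, gauge (p⁻¹ * q) ≤ d p q) (hup : ∀ p q, d p q ≤ A * gauge (p⁻¹ * q)) :
    BiLipschitzEquivalent d dcc := by
  refine ⟨3 * |A| + 23, by linarith [abs_nonneg A], fun p q => ⟨?_, ?_⟩⟩
  · have h1 := dcc_le_gauge p q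
    have h2 := gauge_nonneg (p⁻¹ * q)
    have h3 := hlow p q
    rw [inv_mul_le_iff₀ (by positivity)]
    nlinarith [abs_nonneg A]
  · have h1 := gauge_le_dcc p q
    have h2 := gauge_nonneg (p⁻¹ * q)
    have h3 := hup p q
    nlinarith [abs_nonneg A, le_abs_self A]

/-! ### The vertical profile -/

/-- The oscillation `cos t + cos (√2 t)`, almost periodic but with no period. -/
noncomputable def osc (t : ℝ) : ℝ := Real.cos t + Real.cos (√2 * t)

/-- The distance from the identity to `(0, 0, s)` for `s ≥ 0`: the function `√s` with its coefficient
oscillating aperiodically in the logarithmic scale. The value at `0` is `0`, because of the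
factor `√s`. -/
noncomputable def profile (s : ℝ) : ℝ := √s * (10 + osc (Real.log s / 2))

theorem sqrt_two_le : √2 ≤ 3 / 2 := by
  rw [Real.sqrt_le_left (by norm_num)]; norm_num

theorem abs_cos_sub_cos_le (s t : ℝ) : |Real.cos s - Real.cos t| ≤ |s - t| := by
  have := Real.lipschitzWith_cos.dist_le_mul s t
  simpa [Real.dist_eq] using this

theorem osc_lipschitz (s t : ℝ) : |osc s - osc t| ≤ 5 / 2 * |s - t| := by
  have h1 := abs_cos_sub_cos_le s t
  have h2 := abs_cos_sub_cos_le (√2 * s) (√2 * t)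
  rw [← mul_sub, abs_mul, abs_of_nonneg (Real.sqrt_nonneg 2)] at h2
  have h3 := mul_le_mul_of_nonneg_right sqrt_two_le (abs_nonneg (s - t))
  have h4 : osc s - osc t
      = (Real.cos s - Real.cos t) + (Real.cos (√2 * s) - Real.cos (√2 * t)) := by
    simp only [osc]; ring
  rw [h4]
  linarith [abs_add_le (Real.cos s - Real.cos t) (Real.cos (√2 * s) - Real.cos (√2 * t))]

theorem neg_two_le_osc (t : ℝ) : -2 ≤ osc t := by
  have h1 := Real.neg_one_le_cos t
  have h2 := Real.neg_one_le_cos (√2 * t)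
  simp only [osc]; linarith

theorem osc_le_two (t : ℝ) : osc t ≤ 2 := by
  have h1 := Real.cos_le_one t
  have h2 := Real.cos_le_one (√2 * t)
  simp only [osc]; linarith

theorem profile_zero : profile 0 = 0 := by simp [profile]

theorem profile_exp (t : ℝ) : profile (Real.exp (2 * t)) = Real.exp t * (10 + osc t) := by
  rw [profile, Real.log_exp, mul_div_cancel_left₀ _ two_ne_zero, two_mul, Real.exp_add,
    Real.sqrt_mul_self (Real.exp_pos t).le]

theorem le_profile (s : ℝ) : 8 * √s ≤ profile s := by
  have := neg_two_le_osc (Real.log s / 2)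
  simp only [profile]; nlinarith [Real.sqrt_nonneg s]

theorem profile_le (s : ℝ) : profile s ≤ 12 * √s := by
  have := osc_le_two (Real.log s / 2)
  simp only [profile]; nlinarith [Real.sqrt_nonneg s]

theorem profile_nonneg (s : ℝ) : 0 ≤ profile s :=
  le_trans (by positivity) (le_profile s)

theorem exists_exp_two_mul {s : ℝ} (hs : 0 < s) : ∃ t, s = Real.exp (2 * t) :=
  ⟨Real.log s / 2, by rw [mul_div_cancel₀ _ two_ne_zero, Real.exp_log hs]⟩

/-- If `f` is `m`-Lipschitz and `m ≤ f`, then `exp * f` is monotone: this is the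
derivative-free form of `(exp * f)' = exp * (f + f') ≥ 0`. -/
theorem exp_mul_mono {f : ℝ → ℝ} {m : ℝ} (hm : ∀ t, m ≤ f t) (hm0 : 0 ≤ m)
    (hf : ∀ s t, |f s - f t| ≤ m * |s - t|) {s t : ℝ} (hst : s ≤ t) :
    Real.exp s * f s ≤ Real.exp t * f t := by
  have h1 : Real.exp t = Real.exp s * Real.exp (t - s) := by rw [← Real.exp_add]; ring_nf
  have h2 := Real.add_one_le_exp (t - s)
  have h3 := hf s t
  rw [abs_sub_comm s t, abs_of_nonneg (sub_nonneg.2 hst)] at h3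
  have h4 := le_abs_self (f s - f t)
  have h5 := hm t
  rw [h1, mul_assoc]
  refine mul_le_mul_of_nonneg_left ?_ (Real.exp_pos s).le
  calc f s ≤ f t + m * (t - s) := by linarith
    _ ≤ f t + f t * (t - s) := by nlinarith
    _ = (t - s + 1) * f t := by ring
    _ ≤ Real.exp (t - s) * f t := mul_le_mul_of_nonneg_right h2 (hm0.trans h5)

theorem profile_mono {s S : ℝ} (hs : 0 ≤ s) (hsS : s ≤ S) : profile s ≤ profile S := by
  rcases hs.eq_or_lt with rfl | hs
  · rw [profile_zero]; exact profile_nonneg S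
  obtain ⟨t, rfl⟩ := exists_exp_two_mul hs
  obtain ⟨T, rfl⟩ := exists_exp_two_mul (hs.trans_le hsS)
  have htT : t ≤ T := by have := Real.exp_le_exp.1 hsS; linarith
  rw [profile_exp, profile_exp]
  refine exp_mul_mono (f := fun t => 10 + osc t) (m := 8) (fun t => ?_) (by norm_num)
    (fun s t => ?_) htT
  · linarith [neg_two_le_osc t]
  · rw [add_sub_add_left_eq_sub]
    linarith [osc_lipschitz s t, abs_nonneg (s - t)]

/-- The function `s / g - g / 1000`, for `g = profile s`, is nonnegative and nondecreasing. It is the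
replacement for the convexity of `r ^ 2` in the triangle inequality. -/
theorem profile_ratio {s S : ℝ} (hs : 0 < s) (hsS : s ≤ S) :
    s / profile s - 1 / 1000 * profile s ≤ S / profile S - 1 / 1000 * profile S ∧
      0 ≤ S / profile S - 1 / 1000 * profile S := by
  have key : ∀ t, Real.exp (2 * t) / profile (Real.exp (2 * t))
      - 1 / 1000 * profile (Real.exp (2 * t))
      = Real.exp t * (1 / (10 + osc t) - 1 / 1000 * (10 + osc t)) := by
    intro t
    have h : 10 + osc t ≠ 0 := by linarith [neg_two_le_osc t]
    rw [profile_exp, two_mul, Real.exp_add]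
    field_simp [Real.exp_ne_zero t]
  have hpos : ∀ t, (7 : ℝ) / 100 ≤ 1 / (10 + osc t) - 1 / 1000 * (10 + osc t) := by
    intro t
    have h1 := neg_two_le_osc t
    have h2 := osc_le_two t
    have h3 : (1 : ℝ) / 12 ≤ 1 / (10 + osc t) :=
      one_div_le_one_div_of_le (by linarith) (by linarith)
    linarith
  obtain ⟨t, rfl⟩ := exists_exp_two_mul hs
  obtain ⟨T, rfl⟩ := exists_exp_two_mul (hs.trans_le hsS)
  have htT : t ≤ T := by have := Real.exp_le_exp.1 hsS; linarith
  rw [key, key]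
  refine ⟨exp_mul_mono (f := fun t => 1 / (10 + osc t) - 1 / 1000 * (10 + osc t)) hpos
    (by norm_num) (fun s t => ?_) htT,
    mul_nonneg (Real.exp_pos T).le (le_trans (by norm_num) (hpos T))⟩
  have h1 : 8 ≤ 10 + osc s := by linarith [neg_two_le_osc s]
  have h2 : 8 ≤ 10 + osc t := by linarith [neg_two_le_osc t]
  have h3 := osc_lipschitz s t
  have h4 : 1 / (10 + osc s) - 1 / 1000 * (10 + osc s)
      - (1 / (10 + osc t) - 1 / 1000 * (10 + osc t))
      = -(osc s - osc t) * (1 / ((10 + osc s) * (10 + osc t)) + 1 / 1000) := by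
    field_simp
    ring
  have h5 : 1 / ((10 + osc s) * (10 + osc t)) ≤ 1 / 64 :=
    one_div_le_one_div_of_le (by norm_num) (by nlinarith)
  have h6 : 0 < 1 / ((10 + osc s) * (10 + osc t)) := by positivity
  rw [h4, abs_mul, abs_neg,
    abs_of_pos (by linarith : 0 < 1 / ((10 + osc s) * (10 + osc t)) + 1 / 1000)]
  nlinarith [abs_nonneg (osc s - osc t), abs_nonneg (s - t)]

/-- The inequality behind the triangle inequality for the vertical part: heights `s₁`, `s₂` of
profile at most `a`, `b`, together with an area of at most `a b / 500`, make a height of profile at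
most `a + b`. -/
theorem profile_add_le {s₁ s₂ ω a b : ℝ} (h₁ : 0 ≤ s₁) (h₂ : 0 ≤ s₂) (hω : 0 ≤ ω)
    (ha : profile s₁ ≤ a) (hb : profile s₂ ≤ b) (hab : ω ≤ 1 / 500 * (a * b)) :
    profile (s₁ + s₂ + ω) ≤ a + b := by
  have ha0 := (profile_nonneg s₁).trans ha
  have hb0 := (profile_nonneg s₂).trans hb
  rcases (by positivity : 0 ≤ s₁ + s₂ + ω).eq_or_lt with h0 | h0
  · rw [← h0, profile_zero]; linarith
  set S := s₁ + s₂ + ω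
  set R := S / profile S - 1 / 1000 * profile S with hR
  have hS : 0 < profile S := lt_of_lt_of_le (by positivity) (le_profile S)
  have hR0 : 0 ≤ R := (profile_ratio h0 le_rfl).2
  have hSR : S = profile S * R + 1 / 1000 * profile S ^ 2 := by
    rw [hR]; field_simp; ring
  have key : ∀ s c, 0 ≤ s → s ≤ S → profile s ≤ c → s ≤ c * R + 1 / 1000 * c ^ 2 := by
    intro s c hs hsS hc
    have hc0 := (profile_nonneg s).trans hc
    rcases hs.eq_or_lt with rfl | hs
    · positivity
    have hps : 0 < profile s := lt_of_lt_of_le (by positivity) (le_profile s)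
    have h := (profile_ratio hs hsS).1
    rw [← hR, sub_le_iff_le_add, div_le_iff₀ hps] at h
    nlinarith
  have k1 := key s₁ a h₁ (by simp only [S]; linarith) ha
  have k2 := key s₂ b h₂ (by simp only [S]; linarith) hb
  by_contra! hlt
  have k3 : S ≤ (a + b) * R + 1 / 1000 * (a + b) ^ 2 := by simp only [S]; nlinarith
  nlinarith [mul_le_mul_of_nonneg_right hlt.le hR0]

/-! ### The left-invariant distance -/

/-- The norm inducing the left-invariant distance `leftDist`; its restriction to the vertical axis
is `profile`. -/
noncomputable def oscNorm (h : Heis) : ℝ := max (16 * (|h.x| + |h.y|)) (profile |h.z|)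

theorem oscNorm_mul_le (g h : Heis) : oscNorm (g * h) ≤ oscNorm g + oscNorm h := by
  have g1 : 16 * (|g.x| + |g.y|) ≤ oscNorm g := le_max_left _ _
  have g2 : profile |g.z| ≤ oscNorm g := le_max_right _ _
  have h1 : 16 * (|h.x| + |h.y|) ≤ oscNorm h := le_max_left _ _
  have h2 : profile |h.z| ≤ oscNorm h := le_max_right _ _
  refine max_le ?_ ?_
  · have := abs_add_le g.x h.x
    have := abs_add_le g.y h.y
    simp only [mul_x, mul_y]; linarith
  · set ω := (1 / 2) * (g.x * h.y - g.y * h.x) with hω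
    have hω1 : |ω| ≤ (1 / 2) * ((|g.x| + |g.y|) * (|h.x| + |h.y|)) := by
      have e := abs_sub (g.x * h.y) (g.y * h.x)
      rw [abs_mul, abs_mul] at e
      rw [hω, abs_mul, abs_of_pos (by norm_num : (0 : ℝ) < 1 / 2)]
      nlinarith [mul_nonneg (abs_nonneg g.x) (abs_nonneg h.x),
        mul_nonneg (abs_nonneg g.y) (abs_nonneg h.y)]
    have hω2 : |ω| ≤ 1 / 500 * (oscNorm g * oscNorm h) := by
      have := mul_le_mul g1 h1 (by positivity) (le_trans (by positivity) g1)
      have : 0 ≤ (|g.x| + |g.y|) * (|h.x| + |h.y|) := by positivity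
      linarith
    refine le_trans (profile_mono (abs_nonneg _) ?_)
      (profile_add_le (abs_nonneg _) (abs_nonneg _) (abs_nonneg ω) g2 h2 hω2)
    rw [mul_z]
    exact (abs_add_le _ _).trans (add_le_add (abs_add_le _ _) le_rfl)

theorem gauge_le_oscNorm (h : Heis) : gauge h ≤ oscNorm h := by
  have h1 : 16 * (|h.x| + |h.y|) ≤ oscNorm h := le_max_left _ _
  have h2 : profile |h.z| ≤ oscNorm h := le_max_right _ _
  have h3 := le_profile |h.z|
  have h4 := abs_nonneg h.x
  have h5 := abs_nonneg h.y
  have h6 := Real.sqrt_nonneg |h.z|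
  simp only [gauge]; linarith

theorem oscNorm_le_gauge (h : Heis) : oscNorm h ≤ 16 * gauge h := by
  have h3 := profile_le |h.z|
  have h4 := abs_nonneg h.x
  have h5 := abs_nonneg h.y
  have h6 := Real.sqrt_nonneg |h.z|
  simp only [gauge]
  exact max_le (by linarith) (by linarith)

theorem eq_one_of_gauge_le_zero {h : Heis} (hh : gauge h ≤ 0) : h = 1 := by
  have h1 := abs_nonneg h.x
  have h2 := abs_nonneg h.y
  have h3 := Real.sqrt_nonneg |h.z|
  simp only [gauge] at hh
  have h4 : √|h.z| = 0 := by linarith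
  rw [Real.sqrt_eq_zero (abs_nonneg _)] at h4
  ext
  · exact abs_eq_zero.1 (by linarith)
  · exact abs_eq_zero.1 (by linarith)
  · exact abs_eq_zero.1 h4

/-- The left-invariant distance with aperiodic oscillation. -/
noncomputable def leftDist (p q : Heis) : ℝ := oscNorm (p⁻¹ * q)

theorem leftDist_mul_left (g p q : Heis) : leftDist (g * p) (g * q) = leftDist p q := by
  simp only [leftDist]; group

theorem gauge_le_leftDist (p q : Heis) : gauge (p⁻¹ * q) ≤ leftDist p q := gauge_le_oscNorm _

theorem leftDist_le_gauge (p q : Heis) : leftDist p q ≤ 16 * gauge (p⁻¹ * q) := oscNorm_le_gauge _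

theorem gauge_one : gauge 1 = 0 := by simp [gauge]

/-- The sum of `leftDist` and of a nonnegative multiple of a pseudodistance is a distance. -/
theorem isDistance_leftDist_add {e : Heis → Heis → ℝ} (h0 : ∀ p q, 0 ≤ e p q)
    (hself : ∀ p, e p p = 0) (hsymm : ∀ p q, e p q = e q p)
    (htri : ∀ p q r, e p r ≤ e p q + e q r) :
    IsDistance (fun p q => leftDist p q + e p q) where
  nonneg p q := add_nonneg ((gauge_nonneg _).trans (gauge_le_leftDist p q)) (h0 p q)
  eq_zero_iff p q := by
    constructor
    · intro h
      have h1 := gauge_le_leftDist p q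
      have h2 := h0 p q
      exact inv_mul_eq_one.1 (eq_one_of_gauge_le_zero (by linarith))
    · rintro rfl
      have h1 := gauge_le_leftDist p p
      have h2 := leftDist_le_gauge p p
      rw [inv_mul_cancel, gauge_one] at h1 h2
      rw [hself]; linarith
  symm p q := by
    have : (q⁻¹ * p) = (p⁻¹ * q)⁻¹ := by group
    rw [hsymm p q, leftDist, leftDist, this]
    simp only [oscNorm, inv_x, inv_y, inv_z, abs_neg]
  triangle p q r := by
    have : p⁻¹ * r = (p⁻¹ * q) * (q⁻¹ * r) := by group
    have h1 : leftDist p r ≤ leftDist p q + leftDist q r := by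
      simp only [leftDist]; rw [this]; exact oscNorm_mul_le _ _
    linarith [htri p q r]

/-! ### Aperiodicity -/

/-- Adding to `osc` its translate by half a period of one of the two cosines isolates the other. -/
theorem osc_add_translate (t : ℝ) :
    osc t + osc (t + Real.pi) =
        2 * Real.cos (√2 * Real.pi / 2) * Real.cos (√2 * t + √2 * Real.pi / 2) ∧
      osc t + osc (t + Real.pi / √2) =
        2 * Real.cos (Real.pi / √2 / 2) * Real.cos (t + Real.pi / √2 / 2) := by
  have h2 : √2 * (Real.pi / √2) = Real.pi := by field_simp
  simp only [osc, mul_add, h2, Real.cos_add_pi]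
  constructor
  · have h := Real.cos_add_cos (√2 * t + √2 * Real.pi) (√2 * t)
    rw [show (√2 * t + √2 * Real.pi + √2 * t) / 2 = √2 * t + √2 * Real.pi / 2 by ring,
      show (√2 * t + √2 * Real.pi - √2 * t) / 2 = √2 * Real.pi / 2 by ring] at h
    linarith
  · have h := Real.cos_add_cos (t + Real.pi / √2) t
    rw [show (t + Real.pi / √2 + t) / 2 = t + Real.pi / √2 / 2 by ring,
      show (t + Real.pi / √2 - t) / 2 = Real.pi / √2 / 2 by ring] at h
    linarith

/-- The coefficients in `osc_add_translate` are bounded away from `0`. -/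
theorem one_third_le_abs_cos :
    1 / 3 ≤ |Real.cos (√2 * Real.pi / 2)| ∧ 1 / 3 ≤ |Real.cos (Real.pi / √2 / 2)| := by
  have hs : √2 ^ 2 = 2 := Real.sq_sqrt (by norm_num)
  have h0 : 0 < √2 := by positivity
  have hpi := Real.pi_pos
  have hpi3 := Real.pi_gt_three
  have hpi4 : Real.pi < 3.15 := Real.pi_lt_d2
  have h14 : (1.4 : ℝ) ≤ √2 := Real.le_sqrt_of_sq_le (by norm_num)
  constructor
  · have h : Real.cos (√2 * Real.pi / 2) = -Real.cos (Real.pi - √2 * Real.pi / 2) := by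
      rw [Real.cos_pi_sub, neg_neg]
    rw [h, abs_neg]
    refine le_trans ?_ (le_abs_self _)
    have h1 := Real.one_sub_sq_div_two_le_cos (x := Real.pi - √2 * Real.pi / 2)
    have h2 : 0 ≤ Real.pi - √2 * Real.pi / 2 := by nlinarith [sqrt_two_le]
    have h3 : Real.pi - √2 * Real.pi / 2 ≤ 1 := by nlinarith
    nlinarith
  · refine le_trans ?_ (le_abs_self _)
    have h1 := Real.one_sub_sq_div_two_le_cos (x := Real.pi / √2 / 2)
    have h2 : (Real.pi / √2 / 2) ^ 2 = Real.pi ^ 2 / 8 := by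
      rw [div_pow, div_pow, hs]; ring
    rw [h2] at h1
    nlinarith

/-- A rotation whose orbit stays in the half plane `cos ≥ 1 / 2` is trivial: doubling the angle
multiplies `1 - cos` by at least `3` there. -/
theorem cos_eq_one_of_forall {θ : ℝ} (h : ∀ n : ℕ, 1 / 2 ≤ Real.cos (n * θ)) :
    Real.cos θ = 1 := by
  have key : ∀ k : ℕ, 3 ^ k * (1 - Real.cos θ) ≤ 1 - Real.cos ((2 ^ k : ℕ) * θ) := by
    intro k
    induction k with
    | zero => simp
    | succ k ih =>
      have h1 := h (2 ^ k)
      have h2 : ((2 ^ (k + 1) : ℕ) : ℝ) * θ = 2 * ((2 ^ k : ℕ) * θ) := by push_cast; ring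
      rw [h2, Real.cos_two_mul, pow_succ]
      have h3 := Real.cos_le_one ((2 ^ k : ℕ) * θ)
      nlinarith
  by_contra hne
  have hlt : 0 < 1 - Real.cos θ := by
    have := lt_of_le_of_ne (Real.cos_le_one θ) hne
    linarith
  obtain ⟨k, hk⟩ := pow_unbounded_of_one_lt (1 / (1 - Real.cos θ)) (by norm_num : (1 : ℝ) < 3)
  rw [div_lt_iff₀ hlt] at hk
  have := key k
  have := h (2 ^ k)
  linarith

/-- If two cosines of phase difference `θ` are nearly equal, after both the phase `σ` and the phase
`σ - π / 2`, then `θ` is nearly a multiple of `2 π`. -/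
theorem half_le_cos {σ θ : ℝ} (h1 : |Real.cos (σ + θ) - Real.cos σ| ≤ 2 / 3)
    (h2 : |Real.cos (σ - Real.pi / 2 + θ) - Real.cos (σ - Real.pi / 2)| ≤ 2 / 3) :
    1 / 2 ≤ Real.cos θ := by
  rw [show σ - Real.pi / 2 + θ = σ + θ - Real.pi / 2 by ring, Real.cos_sub_pi_div_two,
    Real.cos_sub_pi_div_two] at h2
  have e : Real.cos θ = Real.cos (σ + θ) * Real.cos σ + Real.sin (σ + θ) * Real.sin σ := by
    rw [← Real.cos_sub]; ring_nf
  have k1 := sq_le_sq' (abs_le.1 h1).1 (abs_le.1 h1).2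
  have k2 := sq_le_sq' (abs_le.1 h2).1 (abs_le.1 h2).2
  nlinarith [Real.sin_sq_add_cos_sq (σ + θ), Real.sin_sq_add_cos_sq σ]

/-- The oscillation is stably aperiodic: translates of `osc` that are asymptotically almost invariant
under every multiple of `T` force `T = 0`. -/
theorem eq_zero_of_osc_translate {s : ℕ → ℝ} {T : ℝ}
    (h : ∀ (t : ℝ) (n : ℕ), ∀ᶠ j in atTop, |osc (s j + t + n * T) - osc (s j + t)| ≤ 1 / 5) :
    T = 0 := by
  obtain ⟨c1, c2⟩ := one_third_le_abs_cos
  have h2 : √2 * (Real.pi / √2) = Real.pi := by field_simp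
  have div : ∀ {c A B : ℝ}, 1 / 3 ≤ |c| → |2 * c * A - 2 * c * B| ≤ 2 / 5 → |A - B| ≤ 2 / 3 := by
    intro c A B hc hAB
    rw [← mul_sub, abs_mul, abs_mul, abs_two] at hAB
    nlinarith [abs_nonneg (A - B)]
  -- Almost invariance of `osc` passes to each of the two cosines.
  have k1 : ∀ (t : ℝ) (n : ℕ), ∀ᶠ j in atTop,
      |Real.cos (√2 * (s j + t) + √2 * Real.pi / 2 + n * (√2 * T))
        - Real.cos (√2 * (s j + t) + √2 * Real.pi / 2)| ≤ 2 / 3 := by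
    intro t n
    filter_upwards [h t n, h (t + Real.pi) n] with j a b
    refine div c1 ?_
    have e1 := (osc_add_translate (s j + t + n * T)).1
    have e2 := (osc_add_translate (s j + t)).1
    rw [show √2 * (s j + t) + √2 * Real.pi / 2 + n * (√2 * T)
      = √2 * (s j + t + n * T) + √2 * Real.pi / 2 by ring, ← e1, ← e2]
    rw [show s j + (t + Real.pi) + n * T = s j + t + n * T + Real.pi by ring,
      show s j + (t + Real.pi) = s j + t + Real.pi by ring] at b
    rw [abs_le] at a b ⊢
    constructor <;> linarith
  have k2 : ∀ (t : ℝ) (n : ℕ), ∀ᶠ j in atTop,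
      |Real.cos (s j + t + Real.pi / √2 / 2 + n * T)
        - Real.cos (s j + t + Real.pi / √2 / 2)| ≤ 2 / 3 := by
    intro t n
    filter_upwards [h t n, h (t + Real.pi / √2) n] with j a b
    refine div c2 ?_
    have e1 := (osc_add_translate (s j + t + n * T)).2
    have e2 := (osc_add_translate (s j + t)).2
    rw [show s j + t + Real.pi / √2 / 2 + n * T = s j + t + n * T + Real.pi / √2 / 2 by ring,
      ← e1, ← e2]
    rw [show s j + (t + Real.pi / √2) + n * T = s j + t + n * T + Real.pi / √2 by ring,
      show s j + (t + Real.pi / √2) = s j + t + Real.pi / √2 by ring] at b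
    rw [abs_le] at a b ⊢
    constructor <;> linarith
  have r1 : Real.cos (√2 * T) = 1 := by
    refine cos_eq_one_of_forall fun n => ?_
    obtain ⟨j, a, b⟩ := ((k1 0 n).and (k1 (-(Real.pi / √2) / 2) n)).exists
    refine half_le_cos a ?_
    rwa [show √2 * (s j + -(Real.pi / √2) / 2) + √2 * Real.pi / 2
      = √2 * (s j + 0) + √2 * Real.pi / 2 - Real.pi / 2 by linear_combination (-1 / 2) * h2] at b
  have r2 : Real.cos T = 1 := by
    refine cos_eq_one_of_forall fun n => ?_
    obtain ⟨j, a, b⟩ := ((k2 0 n).and (k2 (-Real.pi / 2) n)).exists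
    refine half_le_cos a ?_
    rwa [show s j + -Real.pi / 2 + Real.pi / √2 / 2
      = s j + 0 + Real.pi / √2 / 2 - Real.pi / 2 by ring] at b
  obtain ⟨m, hm⟩ := (Real.cos_eq_one_iff _).1 r2
  obtain ⟨m', hm'⟩ := (Real.cos_eq_one_iff _).1 r1
  by_contra hT
  have hm0 : m ≠ 0 := by rintro rfl; simp at hm; exact hT hm.symm
  have e : √2 * m = m' := by
    have h2pi : (2 * Real.pi) ≠ 0 := by positivity
    apply mul_right_cancel₀ h2pi
    rw [hm', ← hm]; ring
  exact ((irrational_sqrt_two.mul_intCast hm0).ne_int m') e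

/-- A distance that differs from `leftDist` by at most a tenth of the gauge distance has no
self-similar blow-up: on the vertical axis, self-similarity of the blow-up would make the
oscillation of the profile nearly periodic. -/
theorem not_selfSimilar_of_isBlowUp {e : Heis → Heis → ℝ} (h0 : ∀ p q, 0 ≤ e p q)
    (he : ∀ p q, e p q ≤ 1 / 10 * gauge (p⁻¹ * q)) {ρ : Heis → Heis → ℝ}
    (hρ : IsBlowUp (fun p q => leftDist p q + e p q) ρ) : ¬ SelfSimilar ρ := by
  rintro ⟨l, hl, hs⟩
  obtain ⟨L, q, hL, -, hlim⟩ := hρ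
  have hl0 : 0 < l := by linarith
  have dil_one : ∀ a : ℝ, dil a 1 = 1 := fun a => by ext <;> simp [dil]
  let v : ℝ → Heis := fun t => ⟨0, 0, Real.exp (2 * t)⟩
  let F : ℝ → ℝ := fun t => Real.exp (-t) * ρ 1 (v t)
  let E : ℕ → ℝ → ℝ := fun j t =>
    Real.exp (-t) * ((1 / L j) * e (q j * dil (L j) 1) (q j * dil (L j) (v t)))
  have hper : ∀ t, F (t + Real.log l) = F t := by
    intro t
    have h1 : v (t + Real.log l) = dil l (v t) := by
      ext
      · simp [v, dil]
      · simp [v, dil]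
      · simp only [v, dil]
        rw [mul_add, Real.exp_add, two_mul (Real.log l), Real.exp_add, Real.exp_log hl0]; ring
    have h2 := hs 1 (v t)
    rw [dil_one] at h2
    simp only [F]
    rw [h1, h2, neg_add, Real.exp_add, Real.exp_neg (Real.log l), Real.exp_log hl0]
    field_simp
  have hpern : ∀ (n : ℕ) t, F (t + n * Real.log l) = F t := by
    intro n
    induction n with
    | zero => simp
    | succ n ih =>
      intro t
      rw [← ih t, ← hper (t + n * Real.log l)]; push_cast; ring_nf
  have hval : ∀ j t, (q j * dil (L j) 1)⁻¹ * (q j * dil (L j) (v t))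
      = ⟨0, 0, Real.exp (2 * (Real.log (L j) + t))⟩ := by
    intro j t
    rw [dil_one, mul_one, inv_mul_cancel_left]
    ext
    · simp [v, dil]
    · simp [v, dil]
    · simp only [v, dil]
      rw [mul_add, Real.exp_add, two_mul (Real.log (L j)), Real.exp_add, Real.exp_log (hL j)]; ring
  have hexp : ∀ j t, Real.exp (Real.log (L j) + t) = L j * Real.exp t := fun j t => by
    rw [Real.exp_add, Real.exp_log (hL j)]
  have hF : ∀ t, Tendsto (fun j => 10 + osc (Real.log (L j) + t) + E j t) atTop (𝓝 (F t)) := by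
    intro t
    refine ((hlim 1 (v t)).const_mul (Real.exp (-t))).congr fun j => ?_
    have hLj := (hL j).ne'
    have h1 : leftDist (q j * dil (L j) 1) (q j * dil (L j) (v t))
        = L j * Real.exp t * (10 + osc (Real.log (L j) + t)) := by
      rw [leftDist, hval, oscNorm, ← hexp, ← profile_exp]
      simp only [abs_zero, add_zero, mul_zero, Real.abs_exp]
      exact max_eq_right (profile_nonneg _)
    simp only [E]
    rw [h1, Real.exp_neg]
    field_simp
  have hE0 : ∀ j t, 0 ≤ E j t := fun j t =>
    mul_nonneg (Real.exp_pos _).le (mul_nonneg (one_div_pos.2 (hL j)).le (h0 _ _))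
  have hE1 : ∀ j t, E j t ≤ 1 / 10 := by
    intro j t
    have h1 := he (q j * dil (L j) 1) (q j * dil (L j) (v t))
    rw [hval] at h1
    have h2 : √(Real.exp (2 * (Real.log (L j) + t))) = L j * Real.exp t := by
      rw [← hexp, two_mul, Real.exp_add, Real.sqrt_mul_self (Real.exp_pos _).le]
    simp only [gauge, abs_zero, zero_add, Real.abs_exp, h2] at h1
    simp only [E]
    rw [Real.exp_neg, inv_mul_le_iff₀ (Real.exp_pos t), one_div, inv_mul_le_iff₀ (hL j)]
    linarith
  have hT : Real.log l = 0 := by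
    refine eq_zero_of_osc_translate (s := fun j => Real.log (L j)) fun t n => ?_
    have hd := (hF (t + n * Real.log l)).sub (hF t)
    rw [hpern, sub_self] at hd
    have hd' := hd.eventually (Metric.ball_mem_nhds (0 : ℝ) (by norm_num : (0 : ℝ) < 1 / 10))
    filter_upwards [hd'] with j hj
    rw [Real.dist_eq, sub_zero, abs_lt, ← add_assoc (Real.log (L j))] at hj
    obtain ⟨ha, hb⟩ := hj
    have a1 := hE0 j t
    have a2 := hE1 j t
    have a3 := hE0 j (t + n * Real.log l)
    have a4 := hE1 j (t + n * Real.log l)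
    rw [abs_le]
    constructor <;> linarith
  exact (Real.log_pos hl).ne' hT

/-! ### The position-dependent pseudodistance -/

/-- The tent function of height and half-width `1 / 2`. -/
noncomputable def tent (x : ℝ) : ℝ := max 0 (1 / 2 - |x|)

/-- A wave in the vertical direction, of amplitude localized in the slab `|x| < 1 / 2`. The phase
`z + x y / 2` is the coordinate for which `X = ∂_x`, so that the horizontal derivatives are
bounded on the slab. -/
noncomputable def wave (p : Heis) : ℂ :=
  tent p.x * Complex.exp (Complex.I * ((p.z + p.x * p.y / 2 : ℝ) : ℂ))

/-- The wave translated to the slab around `x = n` and rescaled by `16 ^ (-k)`, for `i = (k, n)`. -/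
noncomputable def waveAt (i : ℤ × ℤ) (p : Heis) : ℂ :=
  (((16 : ℝ) ^ i.1)⁻¹ : ℝ) * wave (⟨-i.2, 0, 0⟩ * dil (16 ^ i.1) p)

/-- The pseudodistance generated by the waves of all scales and all positions. -/
noncomputable def waveDist (p q : Heis) : ℝ := ⨆ i : ℤ × ℤ, ‖waveAt i p - waveAt i q‖

theorem tent_nonneg (x : ℝ) : 0 ≤ tent x := le_max_left _ _

theorem tent_le_half (x : ℝ) : tent x ≤ 1 / 2 :=
  max_le (by norm_num) (by linarith [abs_nonneg x])

theorem tent_mul_abs_le (x : ℝ) : tent x * |x| ≤ 1 / 4 := by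
  rcases le_total 0 (1 / 2 - |x|) with h | h
  · rw [tent, max_eq_right h]; nlinarith [sq_nonneg (|x| - 1 / 4)]
  · rw [tent, max_eq_left h]; norm_num

theorem abs_tent_sub_le (x y : ℝ) : |tent x - tent y| ≤ |x - y| := by
  have h := abs_max_sub_max_le_max 0 (1 / 2 - |x|) 0 (1 / 2 - |y|)
  rw [sub_self, abs_zero, max_eq_right (abs_nonneg (1 / 2 - |x| - (1 / 2 - |y|))),
    sub_sub_sub_cancel_left] at h
  rw [abs_sub_comm x y]
  exact h.trans (abs_abs_sub_abs_le _ _)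

theorem continuous_tent : Continuous tent := by unfold tent; fun_prop

theorem tent_sub_intCast_le (y : ℝ) (m n : ℤ) : tent (y - n) ≤ |y - m - 1 / 2| := by
  refine max_le (abs_nonneg _) ?_
  have h : (1 : ℝ) / 2 ≤ |(m - n : ℝ) + 1 / 2| := by
    rcases le_or_gt n m with h | h
    · have : (n : ℝ) ≤ m := by exact_mod_cast h
      exact le_trans (by linarith) (le_abs_self _)
    · have : (m : ℝ) + 1 ≤ n := by exact_mod_cast h
      exact le_trans (by linarith) (neg_le_abs _)
  have h2 := abs_sub (y - n) (y - m - 1 / 2)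
  rw [show y - n - (y - m - 1 / 2) = (m - n : ℝ) + 1 / 2 by ring] at h2
  linarith

theorem norm_exp_mul_I (t : ℝ) : ‖Complex.exp (Complex.I * (t : ℂ))‖ = 1 := by
  rw [mul_comm]; exact Complex.norm_exp_ofReal_mul_I t

theorem norm_exp_sub_exp_le (s t : ℝ) :
    ‖Complex.exp (Complex.I * (s : ℂ)) - Complex.exp (Complex.I * (t : ℂ))‖ ≤ |t - s| := by
  have h : Complex.exp (Complex.I * (t : ℂ))
      = Complex.exp (Complex.I * (s : ℂ)) * Complex.exp (Complex.I * ((t - s : ℝ) : ℂ)) := by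
    rw [← Complex.exp_add]; push_cast; ring_nf
  rw [h, norm_sub_rev, ← mul_sub_one, norm_mul, norm_exp_mul_I, one_mul, ← Real.norm_eq_abs]
  exact Real.norm_exp_I_mul_ofReal_sub_one_le

/-- The wave is bounded and its horizontal and vertical derivatives are bounded, so that it is
Lipschitz for the gauge distance. -/
theorem norm_wave_sub_le (p q : Heis) : ‖wave p - wave q‖ ≤ gauge (p⁻¹ * q) := by
  obtain ⟨⟨a, b, c⟩, rfl⟩ : ∃ h, q = p * h := ⟨p⁻¹ * q, (mul_inv_cancel_left p q).symm⟩
  rw [inv_mul_cancel_left]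
  set s := p.z + p.x * p.y / 2 with hs
  set q := p * ⟨a, b, c⟩ with hq
  set t := q.z + q.x * q.y / 2 with ht
  have hts : t - s = c + a * b / 2 + p.x * b := by
    simp only [ht, hs, hq, mul_x, mul_y, mul_z]; ring
  have hwp : wave p = tent p.x * Complex.exp (Complex.I * (s : ℂ)) := rfl
  have hwq : wave q = tent q.x * Complex.exp (Complex.I * (t : ℂ)) := rfl
  have hnorm : ∀ x u : ℝ, ‖(tent x : ℂ) * Complex.exp (Complex.I * (u : ℂ))‖ = tent x := by
    intro x u
    rw [norm_mul, norm_exp_mul_I, mul_one, Complex.norm_real,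
      Real.norm_of_nonneg (tent_nonneg x)]
  have bound1 : ‖wave p - wave q‖ ≤ 1 := by
    refine (norm_sub_le _ _).trans ?_
    rw [hwp, hwq, hnorm, hnorm]
    linarith [tent_le_half p.x, tent_le_half q.x]
  have bound2 : ‖wave p - wave q‖ ≤ tent p.x * |t - s| + |a| := by
    have e : wave p - wave q = tent p.x * (Complex.exp (Complex.I * (s : ℂ))
        - Complex.exp (Complex.I * (t : ℂ)))
        + ((tent p.x - tent q.x : ℝ) : ℂ) * Complex.exp (Complex.I * (t : ℂ)) := by
      rw [hwp, hwq]; push_cast; ring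
    rw [e]
    refine (norm_add_le _ _).trans (add_le_add ?_ ?_)
    · rw [norm_mul, Complex.norm_real, Real.norm_of_nonneg (tent_nonneg _)]
      exact mul_le_mul_of_nonneg_left (norm_exp_sub_exp_le s t) (tent_nonneg _)
    · rw [norm_mul, norm_exp_mul_I, mul_one, Complex.norm_real, Real.norm_eq_abs]
      refine (abs_tent_sub_le _ _).trans ?_
      rw [hq, mul_x, sub_add_cancel_left, abs_neg]
  have h4 : tent p.x * |t - s| ≤ |c| / 2 + |a| * |b| / 4 + |b| / 4 := by
    rw [hts]
    have k1 := abs_add_le (c + a * b / 2) (p.x * b)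
    have k2 := abs_add_le c (a * b / 2)
    rw [abs_mul] at k1
    rw [abs_div, abs_mul, abs_two] at k2
    have k3 := mul_le_mul_of_nonneg_left (k1.trans (add_le_add k2 le_rfl)) (tent_nonneg p.x)
    have k4 := mul_le_mul_of_nonneg_right (tent_mul_abs_le p.x) (abs_nonneg b)
    have k5 := mul_le_mul_of_nonneg_right (tent_le_half p.x)
      (by positivity : 0 ≤ |c| + |a| * |b| / 2)
    linarith
  simp only [gauge]
  have ha := abs_nonneg a
  have hb := abs_nonneg b
  have hc := Real.sqrt_nonneg |c|
  rcases le_total 1 (|a| + |b| + √|c|) with h1 | h1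
  · exact bound1.trans h1
  · have hc2 : |c| ≤ √|c| := by
      have := Real.mul_self_sqrt (abs_nonneg c)
      nlinarith
    nlinarith

theorem norm_waveAt_sub_le (i : ℤ × ℤ) (p q : Heis) :
    ‖waveAt i p - waveAt i q‖ ≤ gauge (p⁻¹ * q) := by
  have hk : (0 : ℝ) < 16 ^ i.1 := by positivity
  rw [waveAt, waveAt, ← mul_sub, norm_mul, Complex.norm_real,
    Real.norm_of_nonneg (inv_pos.2 hk).le, inv_mul_le_iff₀ hk, ← gauge_dil hk, dil_mul, dil_inv]
  refine (norm_wave_sub_le _ _).trans (le_of_eq ?_)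
  group

theorem bddAbove_waveAt (p q : Heis) :
    BddAbove (Set.range fun i : ℤ × ℤ => ‖waveAt i p - waveAt i q‖) :=
  ⟨_, Set.forall_mem_range.2 fun i => norm_waveAt_sub_le i p q⟩

theorem le_waveDist (i : ℤ × ℤ) (p q : Heis) : ‖waveAt i p - waveAt i q‖ ≤ waveDist p q :=
  le_ciSup (bddAbove_waveAt p q) i

theorem waveDist_le_gauge (p q : Heis) : waveDist p q ≤ gauge (p⁻¹ * q) :=
  ciSup_le fun i => norm_waveAt_sub_le i p q

theorem waveDist_nonneg (p q : Heis) : 0 ≤ waveDist p q :=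
  (norm_nonneg _).trans (le_waveDist 0 p q)

theorem waveDist_self (p : Heis) : waveDist p p = 0 := by simp [waveDist]

theorem waveDist_comm (p q : Heis) : waveDist p q = waveDist q p := by
  simp only [waveDist, norm_sub_rev]

theorem waveDist_triangle (p q r : Heis) : waveDist p r ≤ waveDist p q + waveDist q r :=
  ciSup_le fun i => (norm_sub_le_norm_sub_add_norm_sub _ (waveAt i q) _).trans
    (add_le_add (le_waveDist i p q) (le_waveDist i q r))

/-- Along vertical translations only the amplitude of a wave depends on the position, through `x`. -/
theorem norm_waveAt_sub_vertical (i : ℤ × ℤ) (p : Heis) (s : ℝ) :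
    ‖waveAt i p - waveAt i (p * ⟨0, 0, s⟩)‖ = ((16 : ℝ) ^ i.1)⁻¹ *
      (tent (16 ^ i.1 * p.x - i.2) * |2 * Real.sin ((16 ^ i.1) ^ 2 * s / 2)|) := by
  have hk : (0 : ℝ) < 16 ^ i.1 := by positivity
  set r : ℝ := 16 ^ i.1
  have e : wave (⟨-i.2, 0, 0⟩ * dil r (p * ⟨0, 0, s⟩)) =
      wave (⟨-i.2, 0, 0⟩ * dil r p) * Complex.exp (Complex.I * ((r ^ 2 * s : ℝ) : ℂ)) := by
    have hx : (⟨-i.2, 0, 0⟩ * dil r (p * ⟨0, 0, s⟩) : Heis).x =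
        (⟨-i.2, 0, 0⟩ * dil r p : Heis).x := by
      simp [dil]
    rw [wave, wave, hx, mul_assoc, ← Complex.exp_add, ← mul_add, ← Complex.ofReal_add]
    congr 4
    simp [dil]
    ring
  rw [waveAt, waveAt, ← mul_sub, e, norm_mul, Complex.norm_real,
    Real.norm_of_nonneg (inv_pos.2 hk).le, ← mul_one_sub, norm_mul, norm_sub_rev 1,
    Complex.norm_exp_I_mul_ofReal_sub_one, Real.norm_eq_abs, wave, norm_mul, norm_exp_mul_I, mul_one,
    Complex.norm_real, Real.norm_of_nonneg (tent_nonneg _)]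
  simp only [mul_x, dil]
  rw [neg_add_eq_sub]

/-- On vertical pairs the waves of scale `16 ^ (-k)` dominate: finer waves are small, and coarser
waves vary slowly in the vertical direction. -/
theorem waveDist_vertical_le (k : ℤ) (p : Heis) {s B : ℝ} (hs : 0 ≤ s)
    (hB : ∀ n : ℤ, tent (16 ^ k * p.x - n) ≤ B) :
    waveDist p (p * ⟨0, 0, s⟩) ≤
      ((16 : ℝ) ^ k)⁻¹ * max (2 * B) (max (1 / 16) ((16 ^ k) ^ 2 * s / 32)) := by
  refine ciSup_le fun i => ?_
  rw [norm_waveAt_sub_vertical]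
  obtain ⟨k', n⟩ := i
  dsimp only
  have hk : (0 : ℝ) < 16 ^ k := by positivity
  have hk' : (0 : ℝ) < 16 ^ k' := by positivity
  have ht0 := tent_nonneg (16 ^ k' * p.x - n)
  have ht1 := tent_le_half (16 ^ k' * p.x - n)
  have hsin2 : |2 * Real.sin ((16 ^ k') ^ 2 * s / 2)| ≤ 2 := by
    rw [abs_mul, abs_two]; linarith [Real.abs_sin_le_one ((16 ^ k') ^ 2 * s / 2)]
  have hsin : |2 * Real.sin ((16 ^ k') ^ 2 * s / 2)| ≤ (16 ^ k') ^ 2 * s := by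
    have h := Real.abs_sin_le_abs (x := (16 ^ k') ^ 2 * s / 2)
    rw [abs_of_nonneg (by positivity : 0 ≤ (16 ^ k' : ℝ) ^ 2 * s / 2)] at h
    rw [abs_mul, abs_two]; linarith
  have h0 := abs_nonneg (2 * Real.sin ((16 ^ k') ^ 2 * s / 2))
  set w := |2 * Real.sin ((16 ^ k') ^ 2 * s / 2)|
  rcases lt_trichotomy k' k with h | rfl | h
  · have h16 : (16 : ℝ) ^ k' * 16 ≤ 16 ^ k := by
      rw [← zpow_add_one₀ (by norm_num)]
      exact zpow_le_zpow_right₀ (by norm_num) (by omega)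
    refine le_trans ?_ (mul_le_mul_of_nonneg_left
      ((le_max_right (1 / 16) _).trans (le_max_right _ _)) (inv_pos.2 hk).le)
    calc ((16 : ℝ) ^ k')⁻¹ * (tent (16 ^ k' * p.x - n) * w)
        ≤ ((16 : ℝ) ^ k')⁻¹ * (1 / 2 * ((16 ^ k') ^ 2 * s)) := by gcongr
      _ = 16 ^ k' * (s / 2) := by field_simp
      _ ≤ 16 ^ k / 16 * (s / 2) := by
          refine mul_le_mul_of_nonneg_right (by linarith) (by positivity)
      _ = ((16 : ℝ) ^ k)⁻¹ * ((16 ^ k) ^ 2 * s / 32) := by field_simp; ring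
  · refine mul_le_mul_of_nonneg_left (le_trans ?_ (le_max_left _ _)) (inv_pos.2 hk).le
    nlinarith [hB n]
  · have h16 : (16 : ℝ) ^ k * 16 ≤ 16 ^ k' := by
      rw [← zpow_add_one₀ (by norm_num)]
      exact zpow_le_zpow_right₀ (by norm_num) (by omega)
    refine le_trans ?_ (mul_le_mul_of_nonneg_left
      ((le_max_left _ _).trans (le_max_right _ _)) (inv_pos.2 hk).le)
    calc ((16 : ℝ) ^ k')⁻¹ * (tent (16 ^ k' * p.x - n) * w)
        ≤ (16 ^ k * 16)⁻¹ * (1 / 2 * 2) := by gcongr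
      _ = ((16 : ℝ) ^ k)⁻¹ * (1 / 16) := by rw [mul_inv]; ring

/-- Adding a positive multiple of `waveDist` to a left-invariant function destroys left-invariance in
every blow-up: at every scale, the size of a suitable vertical segment oscillates with `x`. -/
theorem not_leftInvariant_of_isBlowUp {d : Heis → Heis → ℝ} (hd : LeftInvariant d) {c : ℝ}
    (hc : 0 < c) {ρ : Heis → Heis → ℝ} (hρ : IsBlowUp (fun p q => d p q + c * waveDist p q) ρ) :
    ¬ LeftInvariant ρ := by
  intro hinv
  obtain ⟨L, q, hL, -, hlim⟩ := hρ
  -- The rescaled dilation factors `r j` and the phases `ξ j` of the base points range over a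
  -- compact set.
  have hk : ∀ j, ∃ k : ℤ, L j * 16 ^ k ∈ Set.Icc (1 / 16 : ℝ) 1 := by
    intro j
    obtain ⟨k, h1, h2⟩ := exists_mem_Ico_zpow (inv_pos.2 (hL j)) (by norm_num : (1 : ℝ) < 16)
    refine ⟨k, ?_, ?_⟩
    · rw [zpow_add_one₀ (by norm_num), inv_lt_iff_one_lt_mul₀ (hL j)] at h2
      linarith
    · rwa [le_inv_comm₀ (by positivity) (hL j), ← one_div, le_div_iff₀ (by positivity)] at h1
  choose k hk using hk
  set r : ℕ → ℝ := fun j => L j * 16 ^ k j with hr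
  set ξ : ℕ → ℝ := fun j => Int.fract (16 ^ k j * (q j).x) with hξ
  obtain ⟨⟨R, Ξ⟩, ⟨hR, -⟩, φ, hφ, hφlim⟩ :=
    (isCompact_Icc.prod isCompact_Icc : IsCompact (Set.Icc (1 / 16 : ℝ) 1 ×ˢ Set.Icc (0 : ℝ) 1))
      |>.tendsto_subseq (x := fun j => (r j, ξ j))
        fun j => ⟨hk j, Int.fract_nonneg _, (Int.fract_lt_one _).le⟩
  have hrlim : Tendsto (fun j => r (φ j)) atTop (𝓝 R) := (continuous_fst.tendsto _).comp hφlim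
  have hξlim : Tendsto (fun j => ξ (φ j)) atTop (𝓝 Ξ) := (continuous_snd.tendsto _).comp hφlim
  have hR0 : 0 < R := lt_of_lt_of_le (by norm_num) hR.1
  have hr0 : ∀ j, 0 < r j := fun j => lt_of_lt_of_le (by norm_num) (hk j).1
  -- Vertical segments of height `τ` over `x = a`: the waves of the relevant scale have full
  -- amplitude at `a₀`, vanish at `a₁`, and make half a turn along the segment.
  set τ : ℝ := Real.pi / R ^ 2 with hτ
  set a₀ : ℝ := -Ξ / R with ha₀
  set a₁ : ℝ := (1 / 2 - Ξ) / R with ha₁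
  let P : ℝ → Heis := fun a => ⟨a, 0, 0⟩
  let v : Heis := ⟨0, 0, τ⟩
  let W : ℕ → ℝ → ℝ := fun j a =>
    (1 / L j) * waveDist (q j * dil (L j) (P a)) (q j * dil (L j) (P a) * ⟨0, 0, L j ^ 2 * τ⟩)
  have hv : ∀ j, dil (L j) v = ⟨0, 0, L j ^ 2 * τ⟩ := fun j => by ext <;> simp [dil, v]
  have hW : Tendsto (fun j => W j a₀ - W j a₁) atTop (𝓝 0) := by
    have e : ρ (P a₀) (P a₀ * v) = ρ (P a₁) (P a₁ * v) := by
      have h0 := hinv (P a₀) 1 v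
      have h1 := hinv (P a₁) 1 v
      rw [mul_one] at h0 h1
      rw [h0, h1]
    have h := (((hlim (P a₀) (P a₀ * v)).sub (hlim (P a₁) (P a₁ * v))).const_mul c⁻¹)
    rw [e, sub_self, mul_zero] at h
    refine h.congr fun j => ?_
    have hdeq : ∀ a, d (q j * dil (L j) (P a)) (q j * dil (L j) (P a) * ⟨0, 0, L j ^ 2 * τ⟩)
        = d 1 ⟨0, 0, L j ^ 2 * τ⟩ := by
      intro a
      have := hd (q j * dil (L j) (P a)) 1 ⟨0, 0, L j ^ 2 * τ⟩
      rwa [mul_one] at this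
    simp only [dil_mul, hv, ← mul_assoc, hdeq, W]
    field_simp
    ring
  have hx : ∀ j a, 16 ^ k j * (q j * dil (L j) (P a)).x
      = ξ j + r j * a + (⌊16 ^ k j * (q j).x⌋ : ℤ) := by
    intro j a
    have := Int.fract_add_floor (16 ^ k j * (q j).x)
    simp only [mul_x, dil, P, hr, hξ]
    linear_combination -this
  have hLr : ∀ j, (1 / L j) * ((16 : ℝ) ^ k j)⁻¹ = (r j)⁻¹ := fun j => by
    rw [hr, mul_inv, one_div]
  have hsr : ∀ j, ((16 : ℝ) ^ k j) ^ 2 * (L j ^ 2 * τ) = r j ^ 2 * τ := fun j => by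
    simp only [hr]; ring
  have lower : ∀ j, (r j)⁻¹ * (tent (ξ j + r j * a₀) * |2 * Real.sin (r j ^ 2 * τ / 2)|)
      ≤ W j a₀ := by
    intro j
    have h := le_waveDist (k j, ⌊16 ^ k j * (q j).x⌋) (q j * dil (L j) (P a₀))
      (q j * dil (L j) (P a₀) * ⟨0, 0, L j ^ 2 * τ⟩)
    rw [norm_waveAt_sub_vertical] at h
    dsimp only at h
    rw [hx, hsr, add_sub_cancel_right] at h
    rw [← hLr, mul_assoc]
    exact mul_le_mul_of_nonneg_left h (one_div_pos.2 (hL j)).le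
  have upper : ∀ j, W j a₁ ≤ (r j)⁻¹ *
      max (2 * |ξ j + r j * a₁ - 1 / 2|) (max (1 / 16) (r j ^ 2 * τ / 32)) := by
    intro j
    have h := waveDist_vertical_le (k j) (q j * dil (L j) (P a₁)) (s := L j ^ 2 * τ)
      (B := |ξ j + r j * a₁ - 1 / 2|) (by positivity) (fun n => by
        have := tent_sub_intCast_le (16 ^ k j * (q j * dil (L j) (P a₁)).x)
          ⌊16 ^ k j * (q j).x⌋ n
        rwa [hx, add_sub_cancel_right, ← hx] at this)
    rw [hsr] at h
    rw [← hLr, mul_assoc]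
    exact mul_le_mul_of_nonneg_left h (one_div_pos.2 (hL j)).le
  have hrinv : Tendsto (fun j => (r (φ j))⁻¹) atTop (𝓝 R⁻¹) := hrlim.inv₀ hR0.ne'
  have hRτ : R ^ 2 * τ = Real.pi := by rw [hτ]; field_simp
  have hturn : Tendsto (fun j => r (φ j) ^ 2 * τ) atTop (𝓝 Real.pi) := by
    rw [← hRτ]; exact (hrlim.pow 2).mul_const τ
  have lowlim : Tendsto (fun j => (r (φ j))⁻¹ * (tent (ξ (φ j) + r (φ j) * a₀) *
      |2 * Real.sin (r (φ j) ^ 2 * τ / 2)|)) atTop (𝓝 R⁻¹) := by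
    have h1 : Tendsto (fun j => ξ (φ j) + r (φ j) * a₀) atTop (𝓝 0) := by
      have h := hξlim.add (hrlim.mul_const a₀)
      rwa [show Ξ + R * a₀ = 0 by rw [ha₀]; field_simp; ring] at h
    have h2 := (continuous_tent.tendsto 0).comp h1
    have h3 := ((Real.continuous_sin.tendsto _).comp (hturn.div_const 2)).const_mul 2 |>.abs
    have h4 := hrinv.mul (h2.mul h3)
    rwa [Real.sin_pi_div_two, show tent 0 = 1 / 2 by norm_num [tent], mul_one, abs_two,
      one_div_mul_cancel two_ne_zero, mul_one] at h4
  have uplim : Tendsto (fun j => (r (φ j))⁻¹ * max (2 * |ξ (φ j) + r (φ j) * a₁ - 1 / 2|)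
      (max (1 / 16) (r (φ j) ^ 2 * τ / 32))) atTop
      (𝓝 (R⁻¹ * max (2 * |(0 : ℝ)|) (max (1 / 16) (Real.pi / 32)))) := by
    have h1 : Tendsto (fun j => ξ (φ j) + r (φ j) * a₁ - 1 / 2) atTop (𝓝 0) := by
      have h := (hξlim.add (hrlim.mul_const a₁)).sub_const (1 / 2)
      rwa [show Ξ + R * a₁ - 1 / 2 = 0 by rw [ha₁]; field_simp; ring] at h
    exact hrinv.mul ((h1.abs.const_mul 2).max (tendsto_const_nhds.max (hturn.div_const 32)))
  have hle := le_of_tendsto_of_tendsto' (lowlim.sub uplim) (hW.comp hφ.tendsto_atTop)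
    fun j => sub_le_sub (lower (φ j)) (upper (φ j))
  have hm : max (2 * |(0 : ℝ)|) (max (1 / 16) (Real.pi / 32)) < 1 := by
    rw [abs_zero, mul_zero]
    exact max_lt one_pos (max_lt (by norm_num) (by linarith [Real.pi_lt_four]))
  have := mul_lt_mul_of_pos_left hm (inv_pos.2 hR0)
  linarith

end Heis

theorem theorem1p5 :
    ∃ d₁ d₂ : Heis → Heis → ℝ,
      Heis.IsDistance d₁ ∧ Heis.IsDistance d₂ ∧
      Heis.BiLipschitzEquivalent d₁ Heis.dcc ∧ Heis.BiLipschitzEquivalent d₂ Heis.dcc ∧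
      (Heis.LeftInvariant d₁ ∧ ∀ ρ, Heis.IsBlowUp d₁ ρ → ¬ Heis.SelfSimilar ρ) ∧
      (∀ ρ, Heis.IsBlowUp d₂ ρ → ¬ Heis.LeftInvariant ρ ∧ ¬ Heis.SelfSimilar ρ) := by
  have hzero : Heis.leftDist = fun p q => Heis.leftDist p q + (fun _ _ => (0 : ℝ)) p q := by
    funext p q; exact (add_zero _).symm
  refine ⟨Heis.leftDist, fun p q => Heis.leftDist p q + 1 / 10 * Heis.waveDist p q,
    ?_, ?_, ?_, ?_, ⟨Heis.leftDist_mul_left, fun ρ hρ => ?_⟩, fun ρ hρ => ⟨?_, ?_⟩⟩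
  · rw [hzero]
    exact Heis.isDistance_leftDist_add (by simp) (by simp) (by simp) (by simp)
  · refine Heis.isDistance_leftDist_add (e := fun p q => 1 / 10 * Heis.waveDist p q)
      (fun p q => ?_) (fun p => ?_) (fun p q => ?_) (fun p q r => ?_)
    · linarith [Heis.waveDist_nonneg p q]
    · rw [Heis.waveDist_self, mul_zero]
    · rw [Heis.waveDist_comm]
    · linarith [Heis.waveDist_triangle p q r]
  · exact Heis.biLipschitzEquivalent_dcc Heis.gauge_le_leftDist Heis.leftDist_le_gauge
  · refine Heis.biLipschitzEquivalent_dcc (A := 17) (fun p q => ?_) (fun p q => ?_)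
    · linarith [Heis.gauge_le_leftDist p q, Heis.waveDist_nonneg p q]
    · linarith [Heis.leftDist_le_gauge p q, Heis.waveDist_le_gauge p q,
        Heis.gauge_nonneg (p⁻¹ * q)]
  · rw [hzero] at hρ
    exact Heis.not_selfSimilar_of_isBlowUp (fun _ _ => le_rfl)
      (fun p q => mul_nonneg (by norm_num) (Heis.gauge_nonneg _)) hρ
  · exact Heis.not_leftInvariant_of_isBlowUp Heis.leftDist_mul_left (by norm_num) hρ
  · exact Heis.not_selfSimilar_of_isBlowUp (e := fun p q => 1 / 10 * Heis.waveDist p q)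
      (fun p q => mul_nonneg (by norm_num) (Heis.waveDist_nonneg p q))
      (fun p q => mul_le_mul_of_nonneg_left (Heis.waveDist_le_gauge p q) (by norm_num)) hρ
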